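/- Fix an irrational $\alpha\in(0,1)$. For $n\ge 1$ let $M_n$ be the random graph on $[n]=\{1,\dots,n\}$ in which the pairs $\{i,j\}$ ($i\neq j$) are edges independently, with probability $p_{|i-j|}$, where $p_\ell=\ell^{-\alpha}$ for $\ell>1$ and $p_1=p_2$. All graphs $A,B,\dots$ below are finite, $A\le B$ means that $A$ is an induced subgraph of $B$, $A<B$ means $A\le B$ and $A\ne B$, and embeddings are embeddings onto induced subgraphs. For $A\le B$ and an equivalence relation $\lambda$ on $B\setminus A$ put $$w_\lambda(A,B)=v_\lambda(A,B)-\alpha\,e_\lambda(A,B),$$ where $v_\lambda(A,B)$ is the number of $\lambda$-classes and $e_\lambda(A,B)$ is the number of edges of $B$ that are contained neither in $A$ nor in a single $\lambda$-class. A set $C\subseteq B\setminus A$ is $\lambda$-closed if it is a union of $\lambda$-classes. Define: - $A<^*_cB$ if $A<B$ and $w_\lambda(A,B)<0$ for every equivalence relation $\lambda$ on $B\setminus A$; - $A\le^*_iB$ if $A\le B$ and $A'<^*_cB$ whenever $A\le A'<B$; - $A\le^*_sB$ if $A\le B$ and there is no $A'\le B$ with $A\le^*_iA'$ and $A\ne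 A'$; - $A<^*_sB$ if $A\le^*_sB$ and $A\neq B$; - $A<^*_{pr}B$ if $A<^*_sB$ and there is no $C$ with $A<^*_sC<^*_sB$. Let $\Xi(A,B)$ be the set of equivalence relations $\lambda$ on $B\setminus A$ such that $w_{\lambda\restriction C}(A,A\cup C)>0$ for every nonempty $\lambda$-closed $C\subseteq B\setminus A$. **Claim.** Suppose $A<^*_{pr}B$. Then the maximum $$\xi=\xi(A,B)=\max\{w_\lambda(A,B):\lambda\in\Xi(A,B)\}$$ exists (that is, $\Xi(A,B)\neq\emptyset$), and for every $\varepsilon>0$, the probability that > for every embedding $f:A\hookrightarrow M_n$, the number of embeddings $g:B\hookrightarrow M_n$ extending $f$ is at most $n^{\xi+\varepsilon}$ tends to $1$ as $n\to\infty$. -/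

import Mathlib

open Filter Topology

/-! Throughout, `A` and `B` are sets of vertices of an ambient graph `G`; each stands for the
subgraph of `G` that it induces, so `A ⊆ B` says that `A` is an induced subgraph of `B`.  An
equivalence relation on `B \ A` is given by a setoid `r` on all vertices, of which only the
restriction to `B \ A` is used; every equivalence relation on `B \ A` arises in this way. -/

namespace DistGraph

section Weights

variable {V : Type*}

/-- The class of `x` under the restriction of `r` to `B \ A`. -/
def cls (A B : Set V) (r : Setoid V) (x : V) : Set V := {y | y ∈ B \ A ∧ r y x}

/-- The number `v_r(A, B)` of equivalence classes of `r` in `B \ A`. -/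
noncomputable def numClasses (A B : Set V) (r : Setoid V) : ℕ :=
  (cls A B r '' (B \ A)).ncard

/-- The edges of `B` that are not contained in `A` and not contained in an `r`-class of `B \ A`. -/
def longEdges (G : SimpleGraph V) (A B : Set V) (r : Setoid V) : Set (Sym2 V) :=
  {e | e ∈ G.edgeSet ∧ (e : Set V) ⊆ B ∧ ¬ (e : Set V) ⊆ A ∧
    ∀ x ∈ B \ A, ¬ (e : Set V) ⊆ cls A B r x}

/-- The weight `w_r(A, B) = v_r(A, B) - α * e_r(A, B)`. -/
noncomputable def weight (α : ℝ) (G : SimpleGraph V) (A B : Set V) (r : Setoid V) : ℝ :=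
  (numClasses A B r : ℝ) - α * ((longEdges G A B r).ncard : ℝ)

/-- `C`, a subset of `B \ A`, is closed under the restriction of `r` to `B \ A`. -/
def IsClosedFor (A B : Set V) (r : Setoid V) (C : Set V) : Prop :=
  ∀ x ∈ C, cls A B r x ⊆ C

/-- `Ξ(A, B)`: the relations all of whose nonempty closed sets `C ⊆ B \ A` have
positive weight `w(A, A ∪ C)`. -/
def Xi (α : ℝ) (G : SimpleGraph V) (A B : Set V) : Set (Setoid V) :=
  {r | ∀ C : Set V, C ⊆ B \ A → C.Nonempty → IsClosedFor A B r C → 0 < weight α G A (A ∪ C) r}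

/-- The set of the weights `w_r(A, B)` for `r` in `Ξ(A, B)`. -/
def xiWeights (α : ℝ) (G : SimpleGraph V) (A B : Set V) : Set ℝ :=
  (fun r => weight α G A B r) '' Xi α G A B

/-- `ξ(A, B)`, the maximum of the weights `w_r(A, B)` for `r` in `Ξ(A, B)`. -/
noncomputable def xi (α : ℝ) (G : SimpleGraph V) (A B : Set V) : ℝ :=
  sSup (xiWeights α G A B)

/-- `A <*_c B`: `A` is a proper subgraph of `B` and every weight `w_r(A, B)` is negative. -/
def LtC (α : ℝ) (G : SimpleGraph V) (A B : Set V) : Prop :=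
  A ⊂ B ∧ ∀ r : Setoid V, weight α G A B r < 0

/-- `A ≤*_i B`. -/
def LeI (α : ℝ) (G : SimpleGraph V) (A B : Set V) : Prop :=
  A ⊆ B ∧ ∀ A' : Set V, A ⊆ A' → A' ⊂ B → LtC α G A' B

/-- `A <*_i B`. -/
def LtI (α : ℝ) (G : SimpleGraph V) (A B : Set V) : Prop :=
  LeI α G A B ∧ A ≠ B

/-- `A ≤*_s B`. -/
def LeS (α : ℝ) (G : SimpleGraph V) (A B : Set V) : Prop :=
  A ⊆ B ∧ ¬ ∃ A' : Set V, LtI α G A A' ∧ A' ⊆ B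

/-- `A <*_s B`. -/
def LtS (α : ℝ) (G : SimpleGraph V) (A B : Set V) : Prop :=
  LeS α G A B ∧ A ≠ B

/-- `A <*_pr B`. -/
def LtPr (α : ℝ) (G : SimpleGraph V) (A B : Set V) : Prop :=
  A ⊆ B ∧ LtS α G A B ∧ ¬ ∃ C : Set V, LtS α G A C ∧ LtS α G C B

end Weights

section RandomGraph

/-- The probability of an edge between two vertices at distance `d ≥ 1`:
`1 / d ^ α` for `d > 1`, and the same value for `d = 1` as for `d = 2`. -/
noncomputable def edgeProb (α : ℝ) (d : ℕ) : ℝ :=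
  if d = 1 then 1 / (2 : ℝ) ^ α else 1 / (d : ℝ) ^ α

open Classical in
/-- The probability that the random graph on `n` vertices in a row, whose edges are drawn
independently, `{i, j}` with probability `edgeProb α |i - j|`, equals `M`. -/
noncomputable def graphProb (α : ℝ) (n : ℕ) (M : SimpleGraph (Fin n)) : ℝ :=
  ∏ p : Fin n × Fin n with p.1 < p.2,
    if M.Adj p.1 p.2 then edgeProb α ((p.2 : ℕ) - (p.1 : ℕ))
    else 1 - edgeProb α ((p.2 : ℕ) - (p.1 : ℕ))

open Classical in
/-- The probability that the random graph on `n` vertices has the property `E`. -/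
noncomputable def prob (α : ℝ) (n : ℕ) (E : SimpleGraph (Fin n) → Prop) : ℝ :=
  ∑ M : SimpleGraph (Fin n) with E M, graphProb α n M

/-- Every random enough graph has the property `E`: its probability tends to `1`. -/
def RandomEnough (α : ℝ) (E : ∀ n : ℕ, SimpleGraph (Fin n) → Prop) : Prop :=
  Tendsto (fun n : ℕ => prob α n (E n)) atTop (𝓝 1)

end RandomGraph

end DistGraph

/-! A placement g of `B` over a base S containing the image of `A` has all its new edges present
with probability at most ∏ len^(-α). At a scale t, join points at distance at most t. Let D be the
set of vertices whose component meets S; the other components form an equivalence relation on `B \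
D`, and only edges longer than t count in its weight. This weight is at most ξ
(`LtPr.weight_le_xi`): irrationality excludes weight zero, and primitivity makes weights over proper
intermediate bases negative, so every positive weight over `A` comes from `Ξ`.

Place the points greedily, each time the one nearest to those already there. Steps longer than t
land in distinct components missing S, so their number is at most ξ + α · (number of new edges
longer than t) (`card_lt_stepGap_le_add`). Integrating against d log t gives ∏ len^(-α) ≤ n^ξ · ∏
(step length)⁻¹ (`prod_len_rpow_le`). Summed over all placements, the last product is
polylogarithmic, as the sums are harmonic (`sum_prod_len_rpow_le`).

The bound is uniform over bases S of bounded size, so copies can be revealed one at a time and the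
k-th moment is at most T^k with T = n^ξ · polylog (`expect_copies_pow_le`). Markov's inequality with
k large in terms of ε and |A| survives the union over the n^|A| maps f. -/

namespace DistGraph

/-! ### Weights, strong extensions and primitive pairs -/

section Deterministic

variable {V : Type*}

theorem mem_cls_self {A B : Set V} {r : Setoid V} {x : V} (hx : x ∈ B \ A) : x ∈ cls A B r x :=
  ⟨hx, r.refl x⟩

theorem cls_eq_of_rel {A B : Set V} {r : Setoid V} {x y : V} (h : r x y) :
    cls A B r x = cls A B r y := by
  ext z
  exact ⟨fun hz => ⟨hz.1, r.trans hz.2 h⟩, fun hz => ⟨hz.1, r.trans hz.2 (r.symm h)⟩⟩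

theorem IsClosedFor.mem_iff {A B C : Set V} {r : Setoid V} (hC : IsClosedFor A B r C)
    {x y : V} (hx : x ∈ B \ A) (hy : y ∈ B \ A) (h : r x y) : x ∈ C ↔ y ∈ C :=
  ⟨fun hxC => hC x hxC ⟨hy, r.symm h⟩, fun hyC => hC y hyC ⟨hx, h⟩⟩

theorem sym2_exists_mem (e : Sym2 V) : ∃ x, x ∈ e := by
  induction e with
  | h x y => exact ⟨x, Sym2.mem_mk_left x y⟩

theorem numClasses_add [Finite V] {A D B : Set V} {r : Setoid V} (hAD : A ⊆ D) (hDB : D ⊆ B)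
    (hD : IsClosedFor A B r (D \ A)) :
    numClasses A B r = numClasses A D r + numClasses D B r := by
  unfold numClasses
  rw [← Set.ncard_union_eq _ (Set.toFinite _) (Set.toFinite _)]
  · congr 1
    have h1 : cls A D r '' (D \ A) = cls A B r '' (D \ A) := by
      refine Set.image_congr fun x hx => ?_
      ext y
      exact ⟨fun hy => ⟨⟨hDB hy.1.1, hy.1.2⟩, hy.2⟩, fun hy => ⟨hD x hx hy, hy.2⟩⟩
    have h2 : cls D B r '' (B \ D) = cls A B r '' (B \ D) := by
      refine Set.image_congr fun x hx => ?_
      ext y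
      refine ⟨fun hy => ⟨⟨hy.1.1, fun h => hy.1.2 (hAD h)⟩, hy.2⟩, fun hy => ⟨⟨hy.1.1, fun h => ?_⟩, hy.2⟩⟩
      exact hx.2 ((hD.mem_iff hy.1 ⟨hx.1, fun h => hx.2 (hAD h)⟩ hy.2).1 ⟨h, hy.1.2⟩).1
    rw [h1, h2, ← Set.image_union]
    congr 1
    ext x
    constructor
    · intro hx
      by_cases h : x ∈ D
      · exact Or.inl ⟨h, hx.2⟩
      · exact Or.inr ⟨hx.1, h⟩
    · rintro (hx | hx)
      · exact ⟨hDB hx.1, hx.2⟩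
      · exact ⟨hx.1, fun h => hx.2 (hAD h)⟩
  · rw [Set.disjoint_left]
    rintro _ ⟨x, hx, rfl⟩ ⟨y, hy, hxy⟩
    have : x ∈ cls D B r y := hxy ▸ mem_cls_self hx
    exact this.1.2 hx.1

theorem longEdges_add [Finite V] (G : SimpleGraph V) {A D B : Set V} {r : Setoid V} (hAD : A ⊆ D)
    (hDB : D ⊆ B) (hD : IsClosedFor A B r (D \ A)) :
    (longEdges G A B r).ncard = (longEdges G A D r).ncard + (longEdges G D B r).ncard := by
  rw [← Set.ncard_union_eq _ (Set.toFinite _) (Set.toFinite _)]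
  · congr 1
    ext e
    constructor
    · rintro ⟨he, heB, heA, hl⟩
      by_cases h : (e : Set V) ⊆ D
      · refine Or.inl ⟨he, h, heA, fun x hx hxe => hl x ⟨hDB hx.1, hx.2⟩ fun y hy => ?_⟩
        have := hxe hy
        exact ⟨⟨hDB this.1.1, this.1.2⟩, this.2⟩
      · refine Or.inr ⟨he, heB, h, fun x hx hxe => hl x ⟨hx.1, fun h => hx.2 (hAD h)⟩ fun y hy => ?_⟩
        have := hxe hy
        exact ⟨⟨this.1.1, fun h => this.1.2 (hAD h)⟩, this.2⟩
    · rintro (⟨he, heD, heA, hl⟩ | ⟨he, heB, heD, hl⟩)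
      · refine ⟨he, heD.trans hDB, heA, fun x hx hxe => ?_⟩
        obtain ⟨y, hy⟩ := sym2_exists_mem e
        have hyc := hxe hy
        have hxD : x ∈ D \ A := (hD.mem_iff hyc.1 hx hyc.2).1 ⟨heD hy, hyc.1.2⟩
        exact hl x hxD fun z hz => ⟨⟨heD hz, (hxe hz).1.2⟩, (hxe hz).2⟩
      · refine ⟨he, heB, fun h => heD (h.trans hAD), fun x hx hxe => ?_⟩
        by_cases hxD : x ∈ D
        · exact heD fun y hy => ((hD.mem_iff hx (hxe hy).1 (r.symm (hxe hy).2)).1 ⟨hxD, hx.2⟩).1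
        · refine hl x ⟨hx.1, hxD⟩ fun y hy => ⟨⟨(hxe hy).1.1, fun h => hxD ?_⟩, (hxe hy).2⟩
          exact ((hD.mem_iff (hxe hy).1 hx (hxe hy).2).1 ⟨h, (hxe hy).1.2⟩).1
  · rw [Set.disjoint_left]
    exact fun e h1 h2 => h2.2.2.1 h1.2.1

/-- Since `D \ A` is a union of classes, no class straddles `D`; hence classes and long edges both
split, an edge that leaves `D` being counted over the base `D`. -/
theorem weight_add [Finite V] (α : ℝ) (G : SimpleGraph V) {A D B : Set V} {r : Setoid V}
    (hAD : A ⊆ D) (hDB : D ⊆ B) (hD : IsClosedFor A B r (D \ A)) :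
    weight α G A B r = weight α G A D r + weight α G D B r := by
  unfold weight
  rw [numClasses_add hAD hDB hD, longEdges_add G hAD hDB hD]
  push_cast
  ring

theorem weight_ne_zero [Finite V] {α : ℝ} (hα : Irrational α) (G : SimpleGraph V) {A B : Set V}
    (hAB : A ⊂ B) (r : Setoid V) : weight α G A B r ≠ 0 := by
  intro h
  have hv : 0 < numClasses A B r := by
    rw [numClasses, Set.ncard_pos]
    exact (Set.nonempty_of_ssubset hAB).image _
  unfold weight at h
  rcases Nat.eq_zero_or_pos (longEdges G A B r).ncard with he | he
  · rw [he] at h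
    simp at h
    omega
  · refine hα ⟨(numClasses A B r : ℚ) / ((longEdges G A B r).ncard : ℚ), ?_⟩
    have : ((longEdges G A B r).ncard : ℝ) ≠ 0 := by positivity
    push_cast
    rw [div_eq_iff this]
    linarith

/-- Take `D` maximal with positive weight. A closed set of nonpositive weight over `D` could be
absorbed into the base without lowering the weight. -/
theorem exists_superset_mem_Xi [Finite V] (α : ℝ) (G : SimpleGraph V) {A B : Set V} {r : Setoid V}
    (hAB : A ⊂ B) (hw : 0 < weight α G A B r) :
    ∃ D, A ⊆ D ∧ D ⊂ B ∧ r ∈ Xi α G D B := by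
  obtain ⟨D, hAD, hmax⟩ := (Set.toFinite {D : Set V | D ⊂ B ∧ 0 < weight α G D B r}).exists_le_maximal
    (a := A) ⟨hAB, hw⟩
  obtain ⟨hDB, hwD⟩ := hmax.prop
  refine ⟨D, hAD, hDB, fun C hC hCne hcl => ?_⟩
  by_contra hneg
  have hsub : D ∪ C ⊆ B := Set.union_subset hDB.subset fun x hx => (hC hx).1
  have hdiff : (D ∪ C) \ D = C := by
    ext x
    exact ⟨fun h => h.1.resolve_left h.2, fun h => ⟨Or.inr h, (hC h).2⟩⟩
  have hadd := weight_add α G (r := r) (Set.subset_union_left (s := D) (t := C)) hsub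
    (by rwa [hdiff])
  by_cases hB : D ∪ C = B
  · rw [hB] at hneg
    exact hneg hwD
  · have hmem : D ∪ C ∈ {D : Set V | D ⊂ B ∧ 0 < weight α G D B r} :=
      ⟨hsub.ssubset_of_ne hB, by linarith⟩
    obtain ⟨x, hx⟩ := hCne
    exact (hC hx).2 (hmax.le_of_ge hmem Set.subset_union_left (Or.inr hx))

/-- Saturating `A'` creates no new class and loses no long edge. This transfers the negative weights
of `LtC` to closed sets, which are all that `Xi` speaks about. -/
theorem weight_saturation_le [Finite V] {α : ℝ} (hα : 0 < α) (G : SimpleGraph V) {D B A' : Set V}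
    (r : Setoid V) (hA' : A' ⊆ B) :
    weight α G D (D ∪ {y | y ∈ B \ D ∧ ∃ x ∈ A' \ D, r y x}) r ≤ weight α G D A' r := by
  set C := {y | y ∈ B \ D ∧ ∃ x ∈ A' \ D, r y x} with hC
  have hsub : A' ⊆ D ∪ C := fun x hx => by
    by_cases h : x ∈ D
    · exact Or.inl h
    · exact Or.inr ⟨⟨hA' hx, h⟩, x, ⟨hx, h⟩, r.refl x⟩
  have hv : numClasses D (D ∪ C) r ≤ numClasses D A' r := by
    unfold numClasses
    have hs : cls D (D ∪ C) r '' ((D ∪ C) \ D) ⊆ cls D (D ∪ C) r '' (A' \ D) := by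
      rintro _ ⟨y, hy, rfl⟩
      obtain ⟨-, x, hx, hyx⟩ := hy.1.resolve_left hy.2
      exact ⟨x, hx, (cls_eq_of_rel hyx).symm⟩
    have hs2 : cls D (D ∪ C) r '' (A' \ D) ⊆
        (fun s : Set V => {y | y ∈ (D ∪ C) \ D ∧ ∃ x ∈ s, r y x}) '' (cls D A' r '' (A' \ D)) := by
      rintro _ ⟨x, hx, rfl⟩
      refine ⟨_, ⟨x, hx, rfl⟩, ?_⟩
      ext y
      constructor
      · rintro ⟨hy, z, hz, hyz⟩
        exact ⟨hy, r.trans hyz hz.2⟩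
      · rintro ⟨hy, hyx⟩
        exact ⟨hy, x, mem_cls_self hx, hyx⟩
    exact (Set.ncard_le_ncard (hs.trans hs2) (Set.toFinite _)).trans
      (Set.ncard_image_le (Set.toFinite _))
  have he : (longEdges G D A' r).ncard ≤ (longEdges G D (D ∪ C) r).ncard := by
    refine Set.ncard_le_ncard ?_ (Set.toFinite _)
    rintro e ⟨he, heA, heD, hl⟩
    refine ⟨he, heA.trans hsub, heD, fun x hx hxe => ?_⟩
    obtain ⟨y, hy⟩ := sym2_exists_mem e
    refine hl y ⟨heA hy, (hxe hy).1.2⟩ fun z hz => ⟨⟨heA hz, (hxe hz).1.2⟩, ?_⟩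
    exact r.trans (hxe hz).2 (r.symm (hxe hy).2)
  unfold weight
  have hv' : (numClasses D (D ∪ C) r : ℝ) ≤ numClasses D A' r := by exact_mod_cast hv
  have he' : ((longEdges G D A' r).ncard : ℝ) ≤ (longEdges G D (D ∪ C) r).ncard := by
    exact_mod_cast he
  nlinarith

theorem ltS_of_mem_Xi [Finite V] {α : ℝ} (hα : 0 < α) (G : SimpleGraph V) {D B : Set V}
    {r : Setoid V} (hDB : D ⊂ B) (hr : r ∈ Xi α G D B) : LtS α G D B := by
  refine ⟨⟨hDB.subset, ?_⟩, hDB.ne⟩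
  rintro ⟨A', ⟨⟨hDA, hI⟩, hne⟩, hAB⟩
  have hss : D ⊂ A' := hDA.ssubset_of_ne hne
  have hneg := (hI D subset_rfl hss).2 r
  have hle := weight_saturation_le hα G (D := D) r hAB
  have hpos := hr {y | y ∈ B \ D ∧ ∃ x ∈ A' \ D, r y x} (fun y hy => hy.1) (by
    obtain ⟨x, hx⟩ := Set.nonempty_of_ssubset hss
    exact ⟨x, ⟨hAB hx.1, hx.2⟩, x, hx, r.refl x⟩) (by
    rintro x ⟨-, z, hz, hxz⟩ y hy
    exact ⟨hy.1, z, hz, r.trans hy.2 hxz⟩)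
  linarith

section Pr

variable [Finite V] {α : ℝ} {G : SimpleGraph V} {A : Set V}

/-- Otherwise the weight is positive, and enlarging `D` to some `E` with `r ∈ Xi α G E Set.univ`
gives a strong extension on both sides of `E`, against primitivity. -/
theorem LtPr.weight_neg (hα : Irrational α) (hα0 : 0 < α) (h : LtPr α G A Set.univ) {D : Set V}
    (hAD : A ⊂ D) (hD : D ≠ Set.univ) (r : Setoid V) : weight α G D Set.univ r < 0 := by
  by_contra hneg
  have hDu : D ⊂ Set.univ := (Set.subset_univ D).ssubset_of_ne hD
  have hpos : 0 < weight α G D Set.univ r :=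
    lt_of_le_of_ne (not_lt.1 hneg) (weight_ne_zero hα G hDu r).symm
  obtain ⟨E, hDE, hE, hr⟩ := exists_superset_mem_Xi α G hDu hpos
  have hAE : A ⊂ E := hAD.trans_subset hDE
  refine h.2.2 ⟨E, ⟨⟨hAE.subset, ?_⟩, hAE.ne⟩, ltS_of_mem_Xi hα0 G hE hr⟩
  rintro ⟨A', hA', -⟩
  exact h.2.1.1.2 ⟨A', hA', Set.subset_univ _⟩

theorem LtPr.mem_Xi (hα : Irrational α) (hα0 : 0 < α) (h : LtPr α G A Set.univ) {r : Setoid V}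
    (hw : 0 < weight α G A Set.univ r) : r ∈ Xi α G A Set.univ := by
  have hA : A ⊂ Set.univ := (Set.subset_univ A).ssubset_of_ne h.2.1.2
  obtain ⟨D, hAD, hD, hr⟩ := exists_superset_mem_Xi α G hA hw
  by_cases hne : A = D
  · rwa [hne]
  · have h1 := h.weight_neg hα hα0 (hAD.ssubset_of_ne hne) hD.ne r
    have h2 := hr (Set.univ \ D) subset_rfl (Set.nonempty_of_ssubset hD) fun x _ y hy => hy.1
    rw [Set.union_sdiff_cancel (Set.subset_univ D)] at h2
    linarith

/-- Strongness forbids `LeI` for the whole pair, so some base `D` carries a nonnegative weight;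
`LtPr.weight_neg` leaves only `D = A`. -/
theorem LtPr.exists_weight_pos (hα : Irrational α) (hα0 : 0 < α) (h : LtPr α G A Set.univ) :
    ∃ r : Setoid V, 0 < weight α G A Set.univ r := by
  have hnot : ¬ LeI α G A Set.univ := fun hI =>
    h.2.1.1.2 ⟨Set.univ, ⟨hI, h.2.1.2⟩, subset_rfl⟩
  simp only [LeI, Set.subset_univ, true_and, not_forall] at hnot
  obtain ⟨D, hAD, hD, hC⟩ := hnot
  simp only [LtC, hD, true_and, not_forall, not_lt] at hC
  obtain ⟨r, hr⟩ := hC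
  have hpos := lt_of_le_of_ne hr (weight_ne_zero hα G hD r).symm
  by_cases hne : A = D
  · exact ⟨r, hne ▸ hpos⟩
  · exact absurd (h.weight_neg hα hα0 (hAD.ssubset_of_ne hne) hD.ne r) (not_lt.2 hr)

theorem finite_xiWeights : (xiWeights α G A Set.univ).Finite := by
  have : Finite (Setoid V) :=
    Finite.of_injective (fun r : Setoid V => fun x y => r x y) fun r s h =>
      Setoid.ext fun x y => by rw [show r x y = s x y from congrFun (congrFun h x) y]
  exact (Set.toFinite _).image _

theorem LtPr.isGreatest_xi (hα : Irrational α) (hα0 : 0 < α) (h : LtPr α G A Set.univ) :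
    IsGreatest (xiWeights α G A Set.univ) (xi α G A Set.univ) := by
  obtain ⟨r, hr⟩ := h.exists_weight_pos hα hα0
  exact ⟨Set.Nonempty.csSup_mem ⟨_, r, h.mem_Xi hα hα0 hr, rfl⟩ finite_xiWeights,
    fun x hx => le_csSup finite_xiWeights.bddAbove hx⟩

theorem LtPr.xi_pos (hα : Irrational α) (hα0 : 0 < α) (h : LtPr α G A Set.univ) :
    0 < xi α G A Set.univ := by
  obtain ⟨r, hr⟩ := h.exists_weight_pos hα hα0
  exact hr.trans_le ((h.isGreatest_xi hα hα0).2 ⟨r, h.mem_Xi hα hα0 hr, rfl⟩)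

/-- The only form in which primitivity enters the counting. Arbitrary bases are needed because
vertices near S get absorbed into the base. -/
theorem LtPr.weight_le_xi (hα : Irrational α) (hα0 : 0 < α) (h : LtPr α G A Set.univ) {D : Set V}
    (hAD : A ⊆ D) (r : Setoid V) : weight α G D Set.univ r ≤ xi α G A Set.univ := by
  have hxi := h.xi_pos hα hα0
  by_cases hne : A = D
  · subst hne
    by_cases hw : 0 < weight α G A Set.univ r
    · exact (h.isGreatest_xi hα hα0).2 ⟨r, h.mem_Xi hα hα0 hw, rfl⟩
    · linarith
  · by_cases hD : D = Set.univ
    · subst hD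
      have : weight α G Set.univ Set.univ r ≤ 0 := by
        simp only [weight, numClasses, Set.sdiff_self, Set.image_empty, Set.ncard_empty]
        have : 0 ≤ α * ((longEdges G Set.univ Set.univ r).ncard : ℝ) := by positivity
        push_cast
        linarith
      linarith
    · linarith [h.weight_neg hα hα0 (hAD.ssubset_of_ne hne) hD r]

end Pr

end Deterministic

end DistGraph

namespace DistGraph

/-! ### Greedy placement and the first-moment estimate -/

section Greedy

/-- The distance of two vertices of the row. -/
def gap {n : ℕ} (x y : Fin n) : ℕ := ((x : ℤ) - (y : ℤ)).natAbs

/-- The distance of the ends of an edge. -/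
def len {n : ℕ} : Sym2 (Fin n) → ℕ :=
  Sym2.lift ⟨gap, fun x y => by unfold gap; omega⟩

/-- The distance of `x` to `Y`, capped at `n`. -/
def setGap {n : ℕ} (x : Fin n) (Y : Finset (Fin n)) : ℕ :=
  (insert n (Y.image (gap x))).min' (Finset.insert_nonempty _ _)

theorem lt_setGap {n t : ℕ} {x : Fin n} {Y : Finset (Fin n)} :
    t < setGap x Y ↔ t < n ∧ ∀ y ∈ Y, t < gap x y := by
  simp [setGap, Finset.lt_min'_iff]

theorem setGap_le {n : ℕ} (x : Fin n) (Y : Finset (Fin n)) : setGap x Y ≤ n :=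
  Finset.min'_le _ _ (Finset.mem_insert_self _ _)

theorem setGap_le_gap {n : ℕ} {x y : Fin n} {Y : Finset (Fin n)} (hy : y ∈ Y) :
    setGap x Y ≤ gap x y :=
  Finset.min'_le _ _ (Finset.mem_insert_of_mem (Finset.mem_image_of_mem _ hy))

theorem setGap_eq {n : ℕ} (x : Fin n) (Y : Finset (Fin n)) :
    setGap x Y = n ∨ ∃ y ∈ Y, gap x y = setGap x Y := by
  have := Finset.min'_mem (insert n (Y.image (gap x))) (Finset.insert_nonempty _ _)
  simpa [setGap] using this

theorem len_le {n : ℕ} (e : Sym2 (Fin n)) : len e ≤ n := by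
  induction e with
  | h x y =>
    change gap x y ≤ n
    unfold gap
    omega

/-- The points of `S` together with those that `h` places before the index `i`. -/
def placed {m n : ℕ} (S : Finset (Fin n)) (h : Fin m → Fin n) (i : Fin m) : Finset (Fin n) :=
  S ∪ (Finset.Iio i).image h

/-- The distances at which `h` places its points, starting from `S`. -/
def stepGap {m n : ℕ} (S : Finset (Fin n)) (h : Fin m → Fin n) (i : Fin m) : ℕ :=
  setGap (h i) (placed S h i)

theorem placed_swap {m n : ℕ} (S : Finset (Fin n)) (h : Fin m → Fin n) {i j l : Fin m}
    (hij : i ≤ j) (hl : l ≤ i) : placed S (h ∘ Equiv.swap i j) l = placed S h l := by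
  unfold placed
  congr 1
  refine Finset.image_congr fun k hk => ?_
  have hk' : k < l := by simpa using hk
  simp only [Function.comp_apply]
  rw [Equiv.swap_apply_of_ne_of_ne (hk'.trans_le hl).ne (hk'.trans_le (hl.trans hij)).ne]

/-- The points can be placed in such an order that each is nearest to those placed before. -/
theorem exists_greedy {V : Type*} [Fintype V] {n : ℕ} (g : V → Fin n) (S : Finset (Fin n)) :
    ∃ π : Fin (Fintype.card V) ≃ V, ∀ i j, i ≤ j →
      stepGap S (g ∘ π) i ≤ setGap (g (π j)) (placed S (g ∘ π) i) := by
  have : Nonempty (Fin (Fintype.card V) ≃ V) := ⟨(Fintype.equivFin V).symm⟩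
  -- A lexicographically least gap sequence is greedy: swapping in a nearer later point keeps the
  -- earlier gaps and lowers the `i`-th.
  obtain ⟨π, hπ⟩ := Finite.exists_min
    fun π : Fin (Fintype.card V) ≃ V => toLex (stepGap S (g ∘ π))
  refine ⟨π, fun i j hij => ?_⟩
  have hcomp : g ∘ ((Equiv.swap i j).trans π) = (g ∘ π) ∘ Equiv.swap i j := rfl
  have h := Pi.apply_le_of_toLex (i := i) (hπ ((Equiv.swap i j).trans π)) fun l hl => by
    rw [hcomp]
    unfold stepGap
    rw [placed_swap S _ hij hl.le]
    simp only [Function.comp_apply]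
    rw [Equiv.swap_apply_of_ne_of_ne hl.ne (hl.trans_le hij).ne]
  rw [hcomp] at h
  unfold stepGap at h ⊢
  rw [placed_swap S _ hij le_rfl] at h
  simpa using h

/-- The components of the graph on the points of `P` that joins points at distance at most `t`. -/
def nearSetoid {n : ℕ} (P : Set (Fin n)) (t : ℕ) : Setoid (Fin n) :=
  Relation.EqvGen.setoid fun x y => x ∈ P ∧ y ∈ P ∧ gap x y ≤ t

theorem gap_comm {n : ℕ} (x y : Fin n) : gap x y = gap y x := by
  unfold gap
  omega

theorem nearSetoid_crossing {n t : ℕ} {P X : Set (Fin n)} {x y : Fin n}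
    (h : nearSetoid P t x y) (hx : x ∈ X) (hy : y ∉ X) :
    ∃ u ∈ X, ∃ v ∈ P, v ∉ X ∧ gap v u ≤ t := by
  by_contra! hno
  have key : ∀ a b, Relation.EqvGen (fun x y => x ∈ P ∧ y ∈ P ∧ gap x y ≤ t) a b →
      (a ∈ X ↔ b ∈ X) := by
    intro a b hab
    induction hab with
    | rel a b hab =>
      constructor
      · intro ha
        by_contra hb
        have h1 := hno a ha b hab.2.1 hb
        rw [gap_comm] at h1
        omega
      · intro hb
        by_contra ha
        have h1 := hno b hb a hab.1 ha
        omega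
    | refl => rfl
    | symm _ _ _ ih => exact ih.symm
    | trans _ _ _ _ _ ih1 ih2 => exact ih1.trans ih2
  exact hy ((key x y h).1 hx)

section Count

variable {V : Type*} [Fintype V] {n : ℕ} {g : V → Fin n} {S : Finset (Fin n)}
  {π : Fin (Fintype.card V) ≃ V}

/-- A chain of short steps out of the placed points would first reach a point not yet placed, within
`t` of a placed one; the greedy choice would then have a gap of at most `t`. -/
theorem not_near_of_lt_stepGap
    (hπ : ∀ i j, i ≤ j → stepGap S (g ∘ π) i ≤ setGap (g (π j)) (placed S (g ∘ π) i))
    {t : ℕ} {i : Fin (Fintype.card V)} (hi : t < stepGap S (g ∘ π) i) {x : Fin n}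
    (hx : x ∈ placed S (g ∘ π) i) : ¬ nearSetoid (S ∪ Set.range g) t x (g (π i)) := by
  intro h
  have hnot : g (π i) ∉ placed S (g ∘ π) i := fun hmem => by
    have h1 := (lt_setGap.1 hi).2 _ hmem
    simp [gap] at h1
  obtain ⟨u, hu, v, hvP, hv, hvu⟩ := nearSetoid_crossing (X := placed S (g ∘ π) i) h hx hnot
  have hv' : v ∉ placed S (g ∘ π) i := hv
  simp only [placed, Finset.mem_union, Finset.mem_image, Finset.mem_Iio, not_or] at hv'
  obtain ⟨w, rfl⟩ := hvP.resolve_left hv'.1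
  have hle : i ≤ π.symm w := by
    by_contra hlt
    exact hv'.2 ⟨π.symm w, not_le.1 hlt, by simp⟩
  have h1 := hπ i _ hle
  rw [Equiv.apply_symm_apply] at h1
  have h2 := setGap_le_gap (x := g w) (Finset.mem_coe.1 hu)
  omega

/-- The number of components at scale `t` which do not meet `S` is at least the number of
points that are placed at distance more than `t`. -/
theorem card_lt_stepGap_le
    (hπ : ∀ i j, i ≤ j → stepGap S (g ∘ π) i ≤ setGap (g (π j)) (placed S (g ∘ π) i)) (t : ℕ) :
    (Finset.univ.filter fun i => t < stepGap S (g ∘ π) i).card ≤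
      numClasses {v | ∃ s ∈ S, nearSetoid (S ∪ Set.range g) t s (g v)} Set.univ
        ((nearSetoid (S ∪ Set.range g) t).comap g) := by
  set r := nearSetoid (S ∪ Set.range g : Set (Fin n)) t with hr
  set D : Set V := {v | ∃ s ∈ S, r s (g v)} with hD
  have hmem : ∀ i, t < stepGap S (g ∘ π) i → π i ∈ Set.univ \ D := by
    rintro i hi
    refine ⟨trivial, ?_⟩
    rintro ⟨s, hs, hsi⟩
    exact not_near_of_lt_stepGap hπ hi (Finset.mem_union_left _ hs) hsi
  have hlt : ∀ i j, i < j → t < stepGap S (g ∘ π) j → ¬ r (g (π i)) (g (π j)) :=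
    fun i j hij hj => not_near_of_lt_stepGap hπ hj
      (Finset.mem_union_right _ (Finset.mem_image.2 ⟨i, Finset.mem_Iio.2 hij, rfl⟩))
  unfold numClasses
  rw [← Set.ncard_coe_finset]
  -- Two far steps cannot share a class: the later point would be near an earlier one, already
  -- placed.
  refine Set.ncard_le_ncard_of_injOn (fun i => cls D Set.univ (r.comap g) (π i)) ?_ ?_
    (Set.toFinite _)
  · intro i hi
    exact ⟨π i, hmem i (by simpa using hi), rfl⟩
  · intro i hi j hj hij
    have hi' : t < stepGap S (g ∘ π) i := by simpa using hi
    have hj' : t < stepGap S (g ∘ π) j := by simpa using hj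
    have hij' : cls D Set.univ (r.comap g) (π i) = cls D Set.univ (r.comap g) (π j) := hij
    have h1 : π i ∈ cls D Set.univ (r.comap g) (π j) := hij' ▸ mem_cls_self (hmem i hi')
    have h2 : r (g (π i)) (g (π j)) := h1.2
    rcases lt_trichotomy i j with h | h | h
    · exact absurd h2 (hlt i j h hj')
    · exact h
    · exact absurd (r.symm h2) (hlt j i h hi')

open Classical in
/-- The edges of `B` which `g` does not map into `S`. -/
noncomputable def outerEdges (B : SimpleGraph V) (g : V → Fin n) (S : Finset (Fin n)) :
    Finset (Sym2 V) :=
  B.edgeFinset.filter fun e => ¬ ∀ x ∈ e, g x ∈ S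

theorem mem_outerEdges {B : SimpleGraph V} {g : V → Fin n} {S : Finset (Fin n)} {e : Sym2 V} :
    e ∈ outerEdges B g S ↔ e ∈ B.edgeSet ∧ ¬ ∀ x ∈ e, g x ∈ S := by
  simp [outerEdges]

theorem longEdges_subset (B : SimpleGraph V) (g : V → Fin n) (S : Finset (Fin n)) (t : ℕ) :
    longEdges B {v | ∃ s ∈ S, nearSetoid (S ∪ Set.range g) t s (g v)} Set.univ
        ((nearSetoid (S ∪ Set.range g) t).comap g) ⊆
      ((outerEdges B g S).filter fun e => t < len (e.map g) : Finset (Sym2 V)) := by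
  set r := nearSetoid (S ∪ Set.range g : Set (Fin n)) t with hr
  set D : Set V := {v | ∃ s ∈ S, r s (g v)} with hD
  rintro e ⟨he, -, heD, hl⟩
  rw [Finset.mem_coe, Finset.mem_filter, mem_outerEdges]
  refine ⟨⟨he, fun h => heD fun x hx => ⟨g x, h x hx, r.refl _⟩⟩, ?_⟩
  by_contra hlen
  induction e with
  | h x y =>
    have hxy : r (g x) (g y) :=
      Relation.EqvGen.rel _ _ ⟨Or.inr ⟨x, rfl⟩, Or.inr ⟨y, rfl⟩, not_lt.1 hlen⟩
    by_cases hx : x ∈ D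
    · obtain ⟨s, hs, hsx⟩ := hx
      refine heD fun z hz => ?_
      rcases Sym2.mem_iff.1 hz with rfl | rfl
      · exact ⟨s, hs, hsx⟩
      · exact ⟨s, hs, r.trans hsx hxy⟩
    · have hy : y ∉ D := fun ⟨s, hs, hsy⟩ => hx ⟨s, hs, r.trans hsy (r.symm hxy)⟩
      refine hl x ⟨trivial, hx⟩ fun z hz => ?_
      rcases Sym2.mem_iff.1 hz with rfl | rfl
      · exact mem_cls_self ⟨trivial, hx⟩
      · exact ⟨⟨trivial, hy⟩, r.symm hxy⟩

theorem card_lt_stepGap_le_add {α : ℝ} (hα : 0 < α) {B : SimpleGraph V} {A : Set V} {ξ : ℝ}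
    (hw : ∀ D, A ⊆ D → ∀ r, weight α B D Set.univ r ≤ ξ) (hgA : ∀ a ∈ A, g a ∈ S)
    (hπ : ∀ i j, i ≤ j → stepGap S (g ∘ π) i ≤ setGap (g (π j)) (placed S (g ∘ π) i)) (t : ℕ) :
    ((Finset.univ.filter fun i => t < stepGap S (g ∘ π) i).card : ℝ) ≤
      ξ + α * ((outerEdges B g S).filter fun e => t < len (e.map g)).card := by
  have h1 := card_lt_stepGap_le hπ t
  have h2 := Set.ncard_le_ncard (longEdges_subset B g S t) (Finset.finite_toSet _)
  rw [Set.ncard_coe_finset] at h2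
  have h3 := hw {v | ∃ s ∈ S, nearSetoid (S ∪ Set.range g) t s (g v)}
    (fun a ha => ⟨g a, hgA a ha, (nearSetoid _ t).refl _⟩) ((nearSetoid (S ∪ Set.range g) t).comap g)
  unfold weight at h3
  have h1' : ((Finset.univ.filter fun i => t < stepGap S (g ∘ π) i).card : ℝ) ≤ _ :=
    Nat.cast_le.2 h1
  have h2' := mul_le_mul_of_nonneg_left (Nat.cast_le (α := ℝ).2 h2) hα.le
  linarith

end Count

theorem sum_Ico_log_sub {d : ℕ} (hd : 1 ≤ d) :
    ∑ t ∈ Finset.Ico 1 d, (Real.log ((t : ℝ) + 1) - Real.log t) = Real.log d := by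
  induction d, hd using Nat.le_induction with
  | base => simp
  | succ d hd ih =>
    rw [Finset.sum_Ico_succ_top hd, ih]
    push_cast
    ring

theorem log_max_one_eq_sum {n d : ℕ} (hd : d ≤ n) :
    Real.log (max (d : ℝ) 1) =
      ∑ t ∈ Finset.Ico 1 n, if t < d then (Real.log ((t : ℝ) + 1) - Real.log t) else 0 := by
  rw [← Finset.sum_filter]
  have : (Finset.Ico 1 n).filter (fun t => t < d) = Finset.Ico 1 d := by
    ext t
    simp only [Finset.mem_filter, Finset.mem_Ico]
    omega
  rw [this]
  rcases Nat.eq_zero_or_pos d with rfl | h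
  · simp
  · rw [sum_Ico_log_sub h, max_eq_left (by exact_mod_cast h)]

/-- Layer-cake formula for the logarithm, which turns inequalities at each scale into one between
products. -/
theorem sum_log_max_one {ι : Type*} (s : Finset ι) (d : ι → ℕ) {n : ℕ} (hd : ∀ i ∈ s, d i ≤ n) :
    ∑ i ∈ s, Real.log (max (d i : ℝ) 1) = ∑ t ∈ Finset.Ico 1 n,
      (Real.log ((t : ℝ) + 1) - Real.log t) * ((s.filter fun i => t < d i).card : ℝ) := by
  rw [Finset.sum_congr rfl fun i hi => log_max_one_eq_sum (hd i hi), Finset.sum_comm]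
  refine Finset.sum_congr rfl fun t _ => ?_
  rw [← Finset.sum_filter, Finset.sum_const, nsmul_eq_mul, mul_comm]

theorem prod_len_rpow_le {V : Type*} [Fintype V] {n : ℕ} (hn : 1 ≤ n) {g : V → Fin n}
    {S : Finset (Fin n)} {α : ℝ} (hα : 0 < α) {B : SimpleGraph V} {A : Set V} {ξ : ℝ}
    (hw : ∀ D, A ⊆ D → ∀ r, weight α B D Set.univ r ≤ ξ) (hgA : ∀ a ∈ A, g a ∈ S) :
    ∃ π : Fin (Fintype.card V) ≃ V,
      ∏ e ∈ outerEdges B g S, (max (len (e.map g) : ℝ) 1) ^ (-α) ≤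
        (n : ℝ) ^ ξ * ∏ i, (max (stepGap S (g ∘ π) i : ℝ) 1)⁻¹ := by
  obtain ⟨π, hπ⟩ := exists_greedy g S
  refine ⟨π, ?_⟩
  have hn' : (0 : ℝ) < n := by exact_mod_cast hn
  have hlog : ∑ i, Real.log (max (stepGap S (g ∘ π) i : ℝ) 1) ≤
      ξ * Real.log n + α * ∑ e ∈ outerEdges B g S, Real.log (max (len (e.map g) : ℝ) 1) := by
    rw [sum_log_max_one Finset.univ (stepGap S (g ∘ π)) fun i _ => setGap_le _ _,
      sum_log_max_one (outerEdges B g S) (fun e => len (Sym2.map g e)) fun e _ => len_le _, ← sum_Ico_log_sub hn,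
      Finset.mul_sum, Finset.mul_sum, ← Finset.sum_add_distrib]
    refine Finset.sum_le_sum fun t ht => ?_
    have ht1 : (0 : ℝ) < t := by exact_mod_cast (Finset.mem_Ico.1 ht).1
    have h0 : 0 ≤ Real.log ((t : ℝ) + 1) - Real.log t :=
      sub_nonneg.2 (Real.log_le_log ht1 (by linarith))
    have h1 := mul_le_mul_of_nonneg_left (card_lt_stepGap_le_add hα hw hgA hπ t) h0
    linarith
  have hpos : ∀ x : ℕ, (0 : ℝ) < max (x : ℝ) 1 := fun x => lt_max_of_lt_right one_pos
  have hP : 0 < ∏ i, max (stepGap S (g ∘ π) i : ℝ) 1 := Finset.prod_pos fun i _ => hpos _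
  have hE : 0 < ∏ e ∈ outerEdges B g S, (max (len (e.map g) : ℝ) 1) ^ (-α) :=
    Finset.prod_pos fun e _ => Real.rpow_pos_of_pos (hpos _) _
  rw [Finset.prod_inv_distrib, ← div_eq_mul_inv, le_div_iff₀ hP,
    ← Real.log_le_log_iff (mul_pos hE hP) (Real.rpow_pos_of_pos hn' _),
    Real.log_mul hE.ne' hP.ne', Real.log_prod fun e _ => (Real.rpow_pos_of_pos (hpos _) _).ne',
    Real.log_prod fun i _ => (hpos _).ne', Real.log_rpow hn',
    Finset.sum_congr rfl fun e _ => Real.log_rpow (hpos _) _, ← Finset.mul_sum]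
  linarith

theorem sum_inv_max_one_le (n : ℕ) :
    ∑ d ∈ Finset.range n, (max (d : ℝ) 1)⁻¹ ≤ 2 + Real.log n := by
  rcases Nat.eq_zero_or_pos n with rfl | hn
  · simp
  have h := harmonic_le_one_add_log n
  have hharm : ((harmonic n : ℚ) : ℝ) = ∑ i ∈ Finset.range n, ((i : ℝ) + 1)⁻¹ := by
    simp [harmonic]
  obtain ⟨m, rfl⟩ : ∃ m, n = m + 1 := ⟨n - 1, by omega⟩
  rw [Finset.sum_range_succ']
  have h1 : ∑ d ∈ Finset.range m, (max ((d + 1 : ℕ) : ℝ) 1)⁻¹ ≤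
      ∑ i ∈ Finset.range (m + 1), ((i : ℝ) + 1)⁻¹ := by
    rw [Finset.sum_range_succ]
    have : (0 : ℝ) ≤ ((m : ℝ) + 1)⁻¹ := by positivity
    refine le_trans (Finset.sum_le_sum fun d _ => ?_) (le_add_of_nonneg_right this)
    rw [max_eq_left (by push_cast; linarith [Nat.cast_nonneg (α := ℝ) d])]
    push_cast
    exact le_rfl
  rw [← hharm] at h1
  simp only [Nat.cast_zero, zero_le_one, sup_of_le_right, inv_one]
  linarith

theorem sum_inv_gap_le {n : ℕ} (y : Fin n) :
    ∑ x : Fin n, (max (gap x y : ℝ) 1)⁻¹ ≤ 4 + 2 * Real.log n := by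
  have hmaps : ∀ x ∈ (Finset.univ : Finset (Fin n)), gap x y ∈ Finset.range n := fun x _ => by
    rw [Finset.mem_range]
    unfold gap
    omega
  rw [← Finset.sum_fiberwise_of_maps_to hmaps]
  have : ∀ d ∈ Finset.range n,
      ∑ x ∈ Finset.univ.filter (fun x : Fin n => gap x y = d), (max (gap x y : ℝ) 1)⁻¹ ≤
        2 * (max (d : ℝ) 1)⁻¹ := by
    intro d _
    rw [Finset.sum_congr rfl fun x hx => by rw [(Finset.mem_filter.1 hx).2], Finset.sum_const,
      nsmul_eq_mul]
    have hcard : (Finset.univ.filter fun x : Fin n => gap x y = d).card ≤ 2 := by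
      refine (Finset.card_le_card_of_injOn (fun x : Fin n => (x : ℕ))
        (t := {(y : ℕ) + d, (y : ℕ) - d}) ?_ fun a _ b _ h => Fin.ext h).trans Finset.card_le_two
      intro x hx
      have : gap x y = d := by simpa using hx
      unfold gap at this
      simp only [Finset.coe_insert, Finset.coe_singleton, Set.mem_insert_iff,
        Set.mem_singleton_iff]
      omega
    have hnn : (0 : ℝ) ≤ (max (d : ℝ) 1)⁻¹ := by positivity
    exact mul_le_mul_of_nonneg_right (by exact_mod_cast hcard) hnn
  refine (Finset.sum_le_sum this).trans ?_
  rw [← Finset.mul_sum]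
  linarith [sum_inv_max_one_le n]

theorem sum_inv_setGap_le {n : ℕ} (Y : Finset (Fin n)) :
    ∑ x : Fin n, (max (setGap x Y : ℝ) 1)⁻¹ ≤ 1 + Y.card * (4 + 2 * Real.log n) := by
  have h : ∀ x : Fin n, (max (setGap x Y : ℝ) 1)⁻¹ ≤
      (n : ℝ)⁻¹ + ∑ y ∈ Y, (max (gap x y : ℝ) 1)⁻¹ := by
    intro x
    have hn : (1 : ℝ) ≤ n := by exact_mod_cast x.pos
    have hsum : (0 : ℝ) ≤ ∑ y ∈ Y, (max (gap x y : ℝ) 1)⁻¹ :=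
      Finset.sum_nonneg fun y _ => by positivity
    rcases setGap_eq x Y with h | ⟨y, hy, h⟩
    · rw [h, max_eq_left hn]
      linarith
    · rw [← h]
      have := Finset.single_le_sum (f := fun y => (max (gap x y : ℝ) 1)⁻¹)
        (fun y _ => by positivity) hy
      have hn0 : (0 : ℝ) ≤ (n : ℝ)⁻¹ := by positivity
      linarith
  refine (Finset.sum_le_sum fun x _ => h x).trans ?_
  rw [Finset.sum_add_distrib, Finset.sum_comm]
  have h1 : ∑ _x : Fin n, (n : ℝ)⁻¹ ≤ 1 := by
    rw [Finset.sum_const, Finset.card_univ, Fintype.card_fin, nsmul_eq_mul]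
    exact mul_inv_le_one
  have h2 : ∑ y ∈ Y, ∑ x : Fin n, (max (gap x y : ℝ) 1)⁻¹ ≤ ∑ _y ∈ Y, (4 + 2 * Real.log n) :=
    Finset.sum_le_sum fun y _ => sum_inv_gap_le y
  rw [Finset.sum_const, nsmul_eq_mul] at h2
  linarith

/-- The last point does not affect earlier gaps, so it can be summed out first; with at most `K`
points present this costs one logarithmic factor. -/
theorem sum_prod_inv_stepGap_le {n : ℕ} (S : Finset (Fin n)) (K : ℕ) (m : ℕ)
    (hK : S.card + m ≤ K) :
    ∑ h : Fin m → Fin n, ∏ i, (max (stepGap S h i : ℝ) 1)⁻¹ ≤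
      (1 + K * (4 + 2 * Real.log n)) ^ m := by
  have hlog : 0 ≤ Real.log (n : ℝ) := Real.log_natCast_nonneg n
  induction m with
  | zero => simp
  | succ m ih =>
    have hplaced : ∀ (p : Fin n × (Fin m → Fin n)) (i : Fin m),
        placed S (Fin.snoc (α := fun _ => Fin n) p.2 p.1) i.castSucc = placed S p.2 i := by
      intro p i
      unfold placed
      congr 1
      ext z
      simp only [Finset.mem_image, Finset.mem_Iio]
      constructor
      · rintro ⟨k, hk, rfl⟩
        have hk' : (k : ℕ) < m := lt_trans (Fin.lt_def.1 hk) (by simp)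
        refine ⟨⟨k, hk'⟩, Fin.lt_def.2 (Fin.lt_def.1 hk), ?_⟩
        rw [← Fin.snoc_castSucc (α := fun _ => Fin n) p.1 p.2]
        rfl
      · rintro ⟨k, hk, rfl⟩
        exact ⟨k.castSucc, by simpa using hk, Fin.snoc_castSucc (α := fun _ => Fin n) _ _ _⟩
    rw [← (Fin.snocEquiv fun _ => Fin n).sum_comp, Fintype.sum_prod_type_right, pow_succ]
    have hstep : ∀ h : Fin m → Fin n, ∑ x : Fin n, ∏ i : Fin (m + 1),
        (max (stepGap S (Fin.snocEquiv (fun _ => Fin n) (x, h)) i : ℝ) 1)⁻¹ ≤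
        (∏ i, (max (stepGap S h i : ℝ) 1)⁻¹) * (1 + K * (4 + 2 * Real.log n)) := by
      intro h
      have heq : ∀ x : Fin n, ∏ i : Fin (m + 1),
          (max (stepGap S (Fin.snocEquiv (fun _ => Fin n) (x, h)) i : ℝ) 1)⁻¹ =
          (∏ i, (max (stepGap S h i : ℝ) 1)⁻¹) *
            (max (setGap x (S ∪ Finset.univ.image h) : ℝ) 1)⁻¹ := by
        intro x
        rw [Fin.prod_univ_castSucc]
        congr 1
        · refine Finset.prod_congr rfl fun i _ => ?_
          have : stepGap S (Fin.snocEquiv (fun _ => Fin n) (x, h)) i.castSucc = stepGap S h i := by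
            unfold stepGap
            change setGap (Fin.snoc (α := fun _ => Fin n) h x i.castSucc)
              (placed S (Fin.snoc (α := fun _ => Fin n) h x) i.castSucc) = _
            rw [hplaced (x, h), Fin.snoc_castSucc]
          rw [this]
        · have : stepGap S (Fin.snocEquiv (fun _ => Fin n) (x, h)) (Fin.last m) =
              setGap x (S ∪ Finset.univ.image h) := by
            unfold stepGap placed
            change setGap (Fin.snoc (α := fun _ => Fin n) h x (Fin.last m))
              (S ∪ (Finset.Iio (Fin.last m)).image (Fin.snoc (α := fun _ => Fin n) h x)) = _
            rw [Fin.snoc_last]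
            congr 2
            ext z
            simp only [Finset.mem_image, Finset.mem_Iio, Finset.mem_univ, true_and]
            constructor
            · rintro ⟨k, hk, rfl⟩
              refine ⟨⟨k, Fin.lt_def.1 hk⟩, ?_⟩
              rw [← Fin.snoc_castSucc (α := fun _ => Fin n) x h]
              rfl
            · rintro ⟨k, rfl⟩
              exact ⟨k.castSucc, Fin.castSucc_lt_last k,
                Fin.snoc_castSucc (α := fun _ => Fin n) _ _ _⟩
          rw [this]
      rw [Finset.sum_congr rfl fun x _ => heq x, ← Finset.mul_sum]
      refine mul_le_mul_of_nonneg_left ((sum_inv_setGap_le _).trans ?_)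
        (Finset.prod_nonneg fun i _ => by positivity)
      have hcard : (S ∪ Finset.univ.image h).card ≤ K := by
        refine (Finset.card_union_le _ _).trans ?_
        have := Finset.card_image_le (s := Finset.univ) (f := h)
        rw [Finset.card_univ, Fintype.card_fin] at this
        omega
      have hcard' : ((S ∪ Finset.univ.image h).card : ℝ) ≤ K := by exact_mod_cast hcard
      nlinarith
    refine (Finset.sum_le_sum fun h _ => hstep h).trans ?_
    rw [← Finset.sum_mul]
    exact mul_le_mul_of_nonneg_right (ih (by omega)) (by positivity)

/-- The expected number of copies of `B`, relative to the vertices in `S`. -/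
theorem sum_prod_len_rpow_le {V : Type*} [Fintype V] [DecidableEq V] {n : ℕ} (hn : 1 ≤ n) (S : Finset (Fin n))
    {α : ℝ} (hα : 0 < α) {B : SimpleGraph V} {A : Set V} {ξ : ℝ}
    (hw : ∀ D, A ⊆ D → ∀ r, weight α B D Set.univ r ≤ ξ) {K : ℕ}
    (hK : S.card + Fintype.card V ≤ K) (s : Finset (V → Fin n))
    (hs : ∀ g ∈ s, ∀ a ∈ A, g a ∈ S) :
    ∑ g ∈ s, ∏ e ∈ outerEdges B g S, (max (len (e.map g) : ℝ) 1) ^ (-α) ≤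
      (n : ℝ) ^ ξ * ((Fintype.card (Fin (Fintype.card V) ≃ V) : ℕ) *
        (1 + K * (4 + 2 * Real.log n)) ^ Fintype.card V) := by
  have hn' : (0 : ℝ) < n := by exact_mod_cast hn
  have hprod : ∀ (g : V → Fin n) (π : Fin (Fintype.card V) ≃ V),
      0 ≤ ∏ i, (max (stepGap S (g ∘ π) i : ℝ) 1)⁻¹ :=
    fun g π => Finset.prod_nonneg fun i _ => by positivity
  calc
    _ ≤ ∑ g ∈ s, (n : ℝ) ^ ξ * ∑ π : Fin (Fintype.card V) ≃ V,
        ∏ i, (max (stepGap S (g ∘ π) i : ℝ) 1)⁻¹ := by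
      refine Finset.sum_le_sum fun g hg => ?_
      obtain ⟨π, hπ⟩ := prod_len_rpow_le hn hα hw (hs g hg)
      refine hπ.trans (mul_le_mul_of_nonneg_left ?_ (Real.rpow_nonneg hn'.le _))
      exact Finset.single_le_sum (f := fun π : Fin (Fintype.card V) ≃ V =>
        ∏ i, (max (stepGap S (g ∘ π) i : ℝ) 1)⁻¹) (fun π _ => hprod g π) (Finset.mem_univ π)
    _ ≤ ∑ g : V → Fin n, (n : ℝ) ^ ξ * ∑ π : Fin (Fintype.card V) ≃ V,
        ∏ i, (max (stepGap S (g ∘ π) i : ℝ) 1)⁻¹ :=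
      Finset.sum_le_sum_of_subset_of_nonneg (Finset.subset_univ s) fun g _ _ =>
        mul_nonneg (Real.rpow_nonneg hn'.le _) (Finset.sum_nonneg fun π _ => hprod g π)
    _ = (n : ℝ) ^ ξ * ∑ π : Fin (Fintype.card V) ≃ V,
        ∑ h : Fin (Fintype.card V) → Fin n, ∏ i, (max (stepGap S h i : ℝ) 1)⁻¹ := by
      rw [← Finset.mul_sum, Finset.sum_comm]
      congr 1
      refine Finset.sum_congr rfl fun π _ => ?_
      exact (π.symm.arrowCongr (Equiv.refl (Fin n))).sum_comp
        fun h => ∏ i, (max (stepGap S h i : ℝ) 1)⁻¹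
    _ ≤ _ := by
      refine mul_le_mul_of_nonneg_left ?_ (Real.rpow_nonneg hn'.le _)
      refine (Finset.sum_le_sum fun π _ => sum_prod_inv_stepGap_le S K _ hK).trans ?_
      rw [Finset.sum_const, Finset.card_univ, nsmul_eq_mul]

end Greedy

end DistGraph

namespace DistGraph

/-! ### Edge probabilities, higher moments and Markov's inequality -/

section Moments

theorem edgeProb_nonneg (α : ℝ) (d : ℕ) : 0 ≤ edgeProb α d := by
  unfold edgeProb
  split_ifs <;> positivity

theorem edgeProb_le_rpow {α : ℝ} (hα : 0 < α) (d : ℕ) :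
    edgeProb α d ≤ (max (d : ℝ) 1) ^ (-α) := by
  unfold edgeProb
  split_ifs with h
  · subst h
    simp only [Nat.cast_one, max_self, Real.one_rpow]
    rw [div_le_one (by positivity)]
    exact Real.one_le_rpow (by norm_num) hα.le
  · rcases Nat.eq_zero_or_pos d with rfl | hd
    · simp [Real.zero_rpow hα.ne']
    · rw [max_eq_left (by exact_mod_cast hd), Real.rpow_neg (Nat.cast_nonneg d), one_div]

theorem edgeProb_le_one {α : ℝ} (hα : 0 < α) (d : ℕ) : edgeProb α d ≤ 1 :=
  (edgeProb_le_rpow hα d).trans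
    (Real.rpow_le_one_of_one_le_of_nonpos (le_max_right _ _) (by linarith))

theorem len_mk_of_lt {n : ℕ} {i j : Fin n} (h : i < j) : len s(i, j) = (j : ℕ) - (i : ℕ) := by
  change gap i j = _
  have := Fin.lt_def.1 h
  unfold gap
  omega

open Classical in
-- Graphs correspond to subsets of the increasing pairs, which index the expanded product.
theorem sum_prod_ite_adj {n : ℕ} (a b : Fin n × Fin n → ℝ) :
    ∑ M : SimpleGraph (Fin n), ∏ p : Fin n × Fin n with p.1 < p.2,
      (if M.Adj p.1 p.2 then a p else b p) =
    ∏ p : Fin n × Fin n with p.1 < p.2, (a p + b p) := by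
  rw [Finset.prod_add]
  refine Finset.sum_nbij
    (fun M => (Finset.univ.filter fun p : Fin n × Fin n => p.1 < p.2).filter
      fun p => M.Adj p.1 p.2) ?_ ?_ ?_ ?_
  · exact fun M _ => Finset.mem_powerset.2 (Finset.filter_subset _ _)
  · intro M _ N _ hMN
    have key : ∀ x y, x < y → (M.Adj x y ↔ N.Adj x y) := fun x y hxy => by
      simpa [hxy] using Finset.ext_iff.1 hMN (x, y)
    ext x y
    rcases lt_trichotomy x y with h | rfl | h
    · exact key x y h
    · simp
    · rw [M.adj_comm, N.adj_comm]
      exact key y x h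
  · intro t ht
    have ht' := Finset.mem_powerset.1 (Finset.mem_coe.1 ht)
    refine ⟨SimpleGraph.fromRel fun x y => (x, y) ∈ t, Finset.mem_coe.2 (Finset.mem_univ _), ?_⟩
    ext ⟨x, y⟩
    simp only [Finset.mem_filter, Finset.mem_univ, true_and, SimpleGraph.fromRel_adj]
    constructor
    · rintro ⟨hxy, -, h | h⟩
      · exact h
      · have := Finset.mem_filter.1 (ht' h)
        exact absurd this.2 hxy.asymm
    · intro h
      have := (Finset.mem_filter.1 (ht' h)).2
      exact ⟨this, this.ne, Or.inl h⟩
  · intro M _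
    rw [Finset.prod_ite, Finset.filter_not]

/-- The expectation of `X` over the random graph on `n` vertices in a row. -/
noncomputable def expect (α : ℝ) (n : ℕ) (X : SimpleGraph (Fin n) → ℝ) : ℝ :=
  open Classical in ∑ M : SimpleGraph (Fin n), graphProb α n M * X M

theorem graphProb_nonneg {α : ℝ} (hα : 0 < α) {n : ℕ} (M : SimpleGraph (Fin n)) :
    0 ≤ graphProb α n M := by
  unfold graphProb
  refine Finset.prod_nonneg fun p _ => ?_
  split_ifs
  · exact edgeProb_nonneg _ _
  · exact sub_nonneg.2 (edgeProb_le_one hα _)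

theorem expect_mono {α : ℝ} (hα : 0 < α) {n : ℕ} {X Y : SimpleGraph (Fin n) → ℝ}
    (h : ∀ M, X M ≤ Y M) : expect α n X ≤ expect α n Y :=
  Finset.sum_le_sum fun M _ => mul_le_mul_of_nonneg_left (h M) (graphProb_nonneg hα M)

theorem expect_sum {α : ℝ} {n : ℕ} {ι : Type*} (s : Finset ι)
    (X : ι → SimpleGraph (Fin n) → ℝ) :
    expect α n (fun M => ∑ i ∈ s, X i M) = ∑ i ∈ s, expect α n (X i) := by
  unfold expect
  simp only [Finset.mul_sum]
  exact Finset.sum_comm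

theorem expect_one (α : ℝ) (n : ℕ) : expect α n (fun _ => 1) = 1 := by
  unfold expect graphProb
  simp only [mul_one]
  refine (sum_prod_ite_adj (fun p => edgeProb α ((p.2 : ℕ) - (p.1 : ℕ)))
    fun p => 1 - edgeProb α ((p.2 : ℕ) - (p.1 : ℕ))).trans ?_
  simp

open Classical in
theorem prob_eq_expect (α : ℝ) (n : ℕ) (E : SimpleGraph (Fin n) → Prop) :
    prob α n E = expect α n fun M => if E M then 1 else 0 := by
  unfold prob expect
  rw [Finset.sum_filter]
  exact Finset.sum_congr rfl fun M _ => by by_cases h : E M <;> simp [h]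

open Classical in
/-- The probability that all pairs in `F` are edges. -/
theorem expect_edges_le {α : ℝ} {n : ℕ} (F : Finset (Sym2 (Fin n))) :
    expect α n (fun M => if ∀ e ∈ F, e ∈ M.edgeSet then 1 else 0) ≤
      ∏ e ∈ F, edgeProb α (len e) := by
  by_cases hdiag : ∃ e ∈ F, e.IsDiag
  · obtain ⟨e, he, hd⟩ := hdiag
    have h0 : ∀ M : SimpleGraph (Fin n), ¬ ∀ e ∈ F, e ∈ M.edgeSet := fun M hM =>
      M.not_isDiag_of_mem_edgeSet (hM e he) hd
    simp only [h0, if_false, expect, mul_zero, Finset.sum_const_zero]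
    exact Finset.prod_nonneg fun e _ => edgeProb_nonneg _ _
  push Not at hdiag
  let q : Fin n × Fin n → ℝ := fun p => edgeProb α ((p.2 : ℕ) - (p.1 : ℕ))
  -- The indicator is absorbed into the product by setting the non-edge factor to zero on `F`.
  have hM : ∀ M : SimpleGraph (Fin n),
      graphProb α n M * (if ∀ e ∈ F, e ∈ M.edgeSet then 1 else 0) =
      ∏ p : Fin n × Fin n with p.1 < p.2,
        (if M.Adj p.1 p.2 then q p else if s(p.1, p.2) ∈ F then 0 else 1 - q p) := by
    intro M
    split_ifs with h
    · rw [mul_one]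
      refine Finset.prod_congr rfl fun p _ => ?_
      by_cases hp : M.Adj p.1 p.2
      · simp only [hp, if_true, q]
      · have : s(p.1, p.2) ∉ F := fun hF => hp (h _ hF)
        simp only [hp, this, if_false, q]
    · rw [mul_zero]
      push Not at h
      obtain ⟨e, he, heM⟩ := h
      have hex : ∃ p : Fin n × Fin n, p.1 < p.2 ∧ s(p.1, p.2) = e := by
        have hnd := hdiag e he
        induction e with
        | h x y =>
          rcases lt_trichotomy x y with h | h | h
          · exact ⟨(x, y), h, rfl⟩
          · exact absurd h hnd
          · exact ⟨(y, x), h, Sym2.eq_swap⟩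
      obtain ⟨p, hp, rfl⟩ := hex
      refine (Finset.prod_eq_zero (i := p) (by simpa using hp) ?_).symm
      have : ¬ M.Adj p.1 p.2 := heM
      rw [if_neg this, if_pos he]
  unfold expect
  rw [Finset.sum_congr rfl fun M _ => hM M, sum_prod_ite_adj]
  have hite : ∀ p : Fin n × Fin n, q p + (if s(p.1, p.2) ∈ F then 0 else 1 - q p) =
      if s(p.1, p.2) ∈ F then q p else 1 := fun p => by split_ifs <;> ring
  rw [Finset.prod_congr rfl fun p _ => hite p, ← Finset.prod_filter]
  refine le_of_eq (Finset.prod_nbij (fun p => s(p.1, p.2)) ?_ ?_ ?_ ?_)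
  · exact fun p hp => (Finset.mem_filter.1 hp).2
  · rintro ⟨x, y⟩ hp ⟨x', y'⟩ hp' h
    have h1 : x < y := by
      have := Finset.mem_filter.1 (Finset.mem_filter.1 (Finset.mem_coe.1 hp)).1
      exact this.2
    have h2 : x' < y' := by
      have := Finset.mem_filter.1 (Finset.mem_filter.1 (Finset.mem_coe.1 hp')).1
      exact this.2
    rcases Sym2.eq_iff.1 h with ⟨rfl, rfl⟩ | ⟨rfl, rfl⟩
    · rfl
    · exact absurd h1 h2.asymm
  · intro e he
    have he' : e ∈ F := he
    have hnd := hdiag e he'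
    induction e with
    | h x y =>
      rcases lt_trichotomy x y with h | h | h
      · exact ⟨(x, y), by simpa [h] using he', rfl⟩
      · exact absurd h hnd
      · refine ⟨(y, x), ?_, Sym2.eq_swap⟩
        rw [Sym2.eq_swap] at he'
        simpa [h] using he'
  · intro p hp
    have := (Finset.mem_filter.1 (Finset.mem_filter.1 hp).1).2
    rw [len_mk_of_lt this]

variable {V : Type*} [Fintype V] {n : ℕ}

open Classical in
/-- The injections of `V` into `Fin n` which extend `f`. -/
noncomputable def extensions (A : Set V) (f : A → Fin n) : Finset (V → Fin n) :=
  Finset.univ.filter fun g => Function.Injective g ∧ ∀ a : A, g a = f a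

open Classical in
/-- The number of injective homomorphisms of `B` into `M` which extend `f`. -/
noncomputable def copies (B : SimpleGraph V) (A : Set V) (f : A → Fin n)
    (M : SimpleGraph (Fin n)) : ℕ :=
  ((extensions A f).filter fun g => ∀ e ∈ B.edgeFinset, e.map g ∈ M.edgeSet).card

open Classical in
-- Images of outer edges leave `S`, hence are new; all other edges of the copy contribute factors at
-- most 1.
theorem prod_edgeProb_union_le {α : ℝ} (hα : 0 < α) (B : SimpleGraph V) {g : V → Fin n}
    (hg : Function.Injective g) {S : Finset (Fin n)} {F : Finset (Sym2 (Fin n))}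
    (hF : ∀ e ∈ F, ∀ x ∈ e, x ∈ S) :
    ∏ e ∈ F ∪ B.edgeFinset.image (Sym2.map g), edgeProb α (len e) ≤
      (∏ e ∈ F, edgeProb α (len e)) *
        ∏ e ∈ outerEdges B g S, (max (len (e.map g) : ℝ) 1) ^ (-α) := by
  have hdisj : Disjoint F ((outerEdges B g S).image (Sym2.map g)) := by
    rw [Finset.disjoint_left]
    intro e he h
    obtain ⟨e', he', rfl⟩ := Finset.mem_image.1 h
    refine (mem_outerEdges.1 he').2 fun x hx => hF _ he _ ?_
    exact Sym2.mem_map.2 ⟨x, hx, rfl⟩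
  have hsub : F ∪ (outerEdges B g S).image (Sym2.map g) ⊆
      F ∪ B.edgeFinset.image (Sym2.map g) :=
    Finset.union_subset_union_right (Finset.image_subset_image fun e he =>
      SimpleGraph.mem_edgeFinset.2 (mem_outerEdges.1 he).1)
  calc
    _ = (∏ e ∈ (F ∪ B.edgeFinset.image (Sym2.map g)) \
            (F ∪ (outerEdges B g S).image (Sym2.map g)), edgeProb α (len e)) *
          ∏ e ∈ F ∪ (outerEdges B g S).image (Sym2.map g), edgeProb α (len e) :=
      (Finset.prod_sdiff hsub).symm
    _ ≤ 1 * ∏ e ∈ F ∪ (outerEdges B g S).image (Sym2.map g), edgeProb α (len e) :=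
      mul_le_mul_of_nonneg_right
        (Finset.prod_le_one (fun e _ => edgeProb_nonneg _ _) fun e _ => edgeProb_le_one hα _)
        (Finset.prod_nonneg fun e _ => edgeProb_nonneg _ _)
    _ = (∏ e ∈ F, edgeProb α (len e)) * ∏ e ∈ outerEdges B g S, edgeProb α (len (e.map g)) := by
      rw [one_mul, Finset.prod_union hdisj,
        Finset.prod_image fun a _ b _ h => Sym2.map.injective hg h]
    _ ≤ _ := by
      refine mul_le_mul_of_nonneg_left ?_ (Finset.prod_nonneg fun e _ => edgeProb_nonneg _ _)
      exact Finset.prod_le_prod (fun e _ => edgeProb_nonneg _ _) fun e _ => edgeProb_le_rpow hα _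

open Classical in
-- Each factor of the power is expanded as a sum over copies. `F` and `S` record the edges and
-- vertices revealed so far, so overlaps between copies are covered by the uniformity of `hT` in
-- `S`.
theorem expect_copies_pow_le {α : ℝ} (hα : 0 < α) (B : SimpleGraph V) {A : Set V} (f : A → Fin n)
    {K : ℕ} {T : ℝ} (hT0 : 0 ≤ T)
    (hT : ∀ S : Finset (Fin n), S.card + Fintype.card V ≤ K → (∀ a, f a ∈ S) →
      ∑ g ∈ extensions A f, ∏ e ∈ outerEdges B g S, (max (len (e.map g) : ℝ) 1) ^ (-α) ≤ T)
    (k : ℕ) (S : Finset (Fin n)) (hS : S.card + k * Fintype.card V ≤ K) (hf : ∀ a, f a ∈ S)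
    (F : Finset (Sym2 (Fin n))) (hF : ∀ e ∈ F, ∀ x ∈ e, x ∈ S) :
    expect α n (fun M => if ∀ e ∈ F, e ∈ M.edgeSet then (copies B A f M : ℝ) ^ k else 0) ≤
      (∏ e ∈ F, edgeProb α (len e)) * T ^ k := by
  induction k generalizing S F with
  | zero => simpa using expect_edges_le F
  | succ k ih =>
    have hle : ∀ M : SimpleGraph (Fin n),
        (if ∀ e ∈ F, e ∈ M.edgeSet then (copies B A f M : ℝ) ^ (k + 1) else 0) ≤
        ∑ g ∈ extensions A f,
          if ∀ e ∈ F ∪ B.edgeFinset.image (Sym2.map g), e ∈ M.edgeSet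
          then (copies B A f M : ℝ) ^ k else 0 := by
      intro M
      split_ifs with h
      · have hiff : ∀ g : V → Fin n,
            (∀ e ∈ F ∪ B.edgeFinset.image (Sym2.map g), e ∈ M.edgeSet) ↔
              ∀ e ∈ B.edgeFinset, e.map g ∈ M.edgeSet := by
          intro g
          constructor
          · exact fun h e he =>
              h _ (Finset.mem_union_right _ (Finset.mem_image_of_mem _ he))
          · intro h' e he
            rcases Finset.mem_union.1 he with he | he
            · exact h e he
            · obtain ⟨e', he', rfl⟩ := Finset.mem_image.1 he
              exact h' e' he'
        simp only [hiff]
        rw [← Finset.sum_filter, Finset.sum_const, nsmul_eq_mul, pow_succ, mul_comm]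
        exact le_rfl
      · exact Finset.sum_nonneg fun g _ => by split_ifs <;> positivity
    refine (expect_mono hα hle).trans ?_
    rw [expect_sum]
    have hg : ∀ g ∈ extensions A f,
        expect α n (fun M => if ∀ e ∈ F ∪ B.edgeFinset.image (Sym2.map g), e ∈ M.edgeSet
          then (copies B A f M : ℝ) ^ k else 0) ≤
        ((∏ e ∈ F, edgeProb α (len e)) * T ^ k) *
          ∏ e ∈ outerEdges B g S, (max (len (e.map g) : ℝ) 1) ^ (-α) := by
      intro g hg
      have hgi : Function.Injective g := (Finset.mem_filter.1 hg).2.1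
      have hcard : (S ∪ Finset.univ.image g).card ≤ S.card + Fintype.card V :=
        (Finset.card_union_le _ _).trans (Nat.add_le_add_left Finset.card_image_le _)
      have h1 := ih (S ∪ Finset.univ.image g)
        (by rw [Nat.succ_mul] at hS; omega) (fun a => Finset.mem_union_left _ (hf a))
        (F ∪ B.edgeFinset.image (Sym2.map g)) (by
          intro e he x hx
          rcases Finset.mem_union.1 he with he | he
          · exact Finset.mem_union_left _ (hF e he x hx)
          · obtain ⟨e', -, rfl⟩ := Finset.mem_image.1 he
            obtain ⟨v, -, rfl⟩ := Sym2.mem_map.1 hx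
            exact Finset.mem_union_right _ (Finset.mem_image_of_mem _ (Finset.mem_univ v)))
      refine h1.trans ?_
      have h2 := mul_le_mul_of_nonneg_right (prod_edgeProb_union_le hα B hgi hF)
        (pow_nonneg hT0 k)
      refine h2.trans (le_of_eq ?_)
      ring
    refine (Finset.sum_le_sum hg).trans ?_
    rw [← Finset.mul_sum, pow_succ, ← mul_assoc]
    refine mul_le_mul_of_nonneg_left (hT S ?_ hf)
      (mul_nonneg (Finset.prod_nonneg fun e _ => edgeProb_nonneg _ _) (pow_nonneg hT0 k))
    rw [Nat.succ_mul] at hS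
    omega

theorem ncard_embeddings_le (B : SimpleGraph V) {A : Set V} {M : SimpleGraph (Fin n)}
    (f : B.induce A ↪g M) :
    {g : B ↪g M | ∀ a : A, g (a : V) = f a}.ncard ≤ copies B A (fun a => f a) M := by
  classical
  unfold copies
  rw [← Set.ncard_coe_finset]
  refine Set.ncard_le_ncard_of_injOn (fun g : B ↪g M => (g : V → Fin n)) ?_ ?_
    (Finset.finite_toSet _)
  · intro g hg
    refine Finset.mem_coe.2 (Finset.mem_filter.2
      ⟨Finset.mem_filter.2 ⟨Finset.mem_univ _, g.injective, hg⟩, fun e he => ?_⟩)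
    rw [SimpleGraph.mem_edgeFinset] at he
    induction e with
    | h x y => exact g.map_rel_iff.2 he
  · exact fun g _ g' _ h => DFunLike.coe_injective h

/-- Markov's inequality for the `k`-th moments of the numbers of extensions. -/
theorem one_sub_prob_le {α : ℝ} (hα : 0 < α) (B : SimpleGraph V) (A : Set V) {T X : ℝ} {k : ℕ}
    (hX : 0 < X) (hmom : ∀ f : A → Fin n, expect α n (fun M => (copies B A f M : ℝ) ^ k) ≤ T ^ k) :
    1 - prob α n (fun M => ∀ f : B.induce A ↪g M,
        (({g : B ↪g M | ∀ a : A, g (a : V) = f a}.ncard : ℕ) : ℝ) ≤ X) ≤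
      (n : ℝ) ^ Nat.card A * (T ^ k / X ^ k) := by
  classical
  -- The embeddings `f` depend on `M`; the sum runs over all maps from `A` instead, so that it can
  -- be exchanged with the expectation.
  have hle : expect α n (fun _ => 1) ≤ prob α n (fun M => ∀ f : B.induce A ↪g M,
      (({g : B ↪g M | ∀ a : A, g (a : V) = f a}.ncard : ℕ) : ℝ) ≤ X) +
      expect α n (fun M => ∑ f : A → Fin n, (copies B A f M : ℝ) ^ k * (X ^ k)⁻¹) := by
    rw [prob_eq_expect]
    unfold expect
    rw [← Finset.sum_add_distrib]
    refine Finset.sum_le_sum fun M _ => ?_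
    rw [← mul_add]
    refine mul_le_mul_of_nonneg_left ?_ (graphProb_nonneg hα M)
    have hnn : ∀ f : A → Fin n, 0 ≤ (copies B A f M : ℝ) ^ k * (X ^ k)⁻¹ := fun f => by
      positivity
    beta_reduce
    split_ifs with h
    · exact le_add_of_nonneg_right (Finset.sum_nonneg fun f _ => hnn f)
    · push Not at h
      obtain ⟨f, hf⟩ := h
      have h1 : X ≤ copies B A (fun a => f a) M :=
        hf.le.trans (Nat.cast_le.2 (ncard_embeddings_le B f))
      have h2 : 1 ≤ (copies B A (fun a => f a) M : ℝ) ^ k * (X ^ k)⁻¹ := by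
        rw [← div_eq_mul_inv, one_le_div (pow_pos hX k)]
        exact pow_le_pow_left₀ hX.le h1 k
      rw [zero_add]
      exact h2.trans (Finset.single_le_sum
        (f := fun f : A → Fin n => (copies B A f M : ℝ) ^ k * (X ^ k)⁻¹) (fun f _ => hnn f)
        (Finset.mem_univ fun a => f a))
  rw [expect_sum, expect_one] at hle
  have hsum : ∑ f : A → Fin n, expect α n (fun M => (copies B A f M : ℝ) ^ k * (X ^ k)⁻¹) ≤
      (n : ℝ) ^ Nat.card A * (T ^ k / X ^ k) := by
    have h1 : ∀ f : A → Fin n,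
        expect α n (fun M => (copies B A f M : ℝ) ^ k * (X ^ k)⁻¹) ≤ T ^ k / X ^ k := by
      intro f
      have h2 : expect α n (fun M => (copies B A f M : ℝ) ^ k * (X ^ k)⁻¹) =
          expect α n (fun M => (copies B A f M : ℝ) ^ k) * (X ^ k)⁻¹ := by
        unfold expect
        rw [Finset.sum_mul]
        exact Finset.sum_congr rfl fun M _ => by ring
      rw [h2, div_eq_mul_inv]
      exact mul_le_mul_of_nonneg_right (hmom f) (by positivity)
    refine (Finset.sum_le_sum fun f _ => h1 f).trans (le_of_eq ?_)
    rw [Finset.sum_const, Finset.card_univ, nsmul_eq_mul, Fintype.card_fun, Fintype.card_fin,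
      Nat.card_eq_fintype_card]
    push_cast
    rfl
  linarith

theorem prob_le_one {α : ℝ} (hα : 0 < α) (n : ℕ) (E : SimpleGraph (Fin n) → Prop) :
    prob α n E ≤ 1 := by
  classical
  rw [prob_eq_expect]
  refine (expect_mono hα fun M => ?_).trans (expect_one α n).le
  split_ifs <;> norm_num

end Moments

/-! ### Logarithms against a power of n -/

section Asymptotics

theorem tendsto_log_pow_div (C : ℝ) (j : ℕ) :
    Tendsto (fun n : ℕ => C * (Real.log n ^ j / n)) atTop (𝓝 0) := by
  have h := (Real.isLittleO_pow_log_id_atTop (n := j)).tendsto_div_nhds_zero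
  simpa using (h.comp tendsto_natCast_atTop_atTop).const_mul C

/-- The powers n^ξ cancel, and n^(εk) beats n^a with one factor n to spare. The bound `3 ≤ n`
ensures log n ≥ 1, which absorbs the constants. -/
theorem moment_ratio_le {n a k m c K : ℕ} (hn : 3 ≤ n) {ξ ε : ℝ} (hk : (a : ℝ) + 1 ≤ ε * k) :
    (n : ℝ) ^ a * (((n : ℝ) ^ ξ * (c * (1 + K * (4 + 2 * Real.log n)) ^ m)) ^ k /
      ((n : ℝ) ^ (ξ + ε)) ^ k) ≤
    ((c : ℝ) * (1 + 6 * K) ^ m) ^ k * (Real.log n ^ (m * k) / n) := by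
  have hn' : (3 : ℝ) ≤ n := by exact_mod_cast hn
  have hn0 : (0 : ℝ) < n := by linarith
  have hlog : 1 ≤ Real.log n := by
    rw [Real.le_log_iff_exp_le hn0]
    exact (Real.exp_one_lt_d9.le.trans (by norm_num)).trans hn'
  have hL : 1 + (K : ℝ) * (4 + 2 * Real.log n) ≤ (1 + 6 * K) * Real.log n := by
    have := mul_le_mul_of_nonneg_left hlog (Nat.cast_nonneg (α := ℝ) K)
    linarith
  have hx : (0 : ℝ) < (n : ℝ) ^ ξ := Real.rpow_pos_of_pos hn0 _
  have hbase : (c : ℝ) * (1 + K * (4 + 2 * Real.log n)) ^ m ≤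
      (c * (1 + 6 * K) ^ m) * Real.log n ^ m := by
    rw [mul_assoc, ← mul_pow]
    exact mul_le_mul_of_nonneg_left (pow_le_pow_left₀ (by positivity) hL m) (Nat.cast_nonneg c)
  have hpow := pow_le_pow_left₀ (by positivity) hbase k
  have hε : (n : ℝ) ^ (a + 1) ≤ ((n : ℝ) ^ ε) ^ k := by
    rw [← Real.rpow_natCast (n : ℝ) (a + 1), ← Real.rpow_mul_natCast hn0.le]
    refine Real.rpow_le_rpow_of_exponent_le (by linarith) ?_
    push_cast
    exact hk
  have hεpos : (0 : ℝ) < ((n : ℝ) ^ ε) ^ k := pow_pos (Real.rpow_pos_of_pos hn0 _) _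
  rw [Real.rpow_add hn0, mul_pow, mul_pow ((n : ℝ) ^ ξ), mul_div_mul_left _ _ (pow_pos hx k).ne']
  rw [mul_pow _ (Real.log n ^ m), ← pow_mul] at hpow
  have hR : 0 ≤ ((c : ℝ) * (1 + 6 * K) ^ m) ^ k * Real.log n ^ (m * k) := by positivity
  calc
    _ ≤ (n : ℝ) ^ a * ((((c : ℝ) * (1 + 6 * K) ^ m) ^ k * Real.log n ^ (m * k)) /
        (n : ℝ) ^ (a + 1)) := by
      refine mul_le_mul_of_nonneg_left ?_ (by positivity)
      exact div_le_div₀ hR hpow (by positivity) hε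
    _ = _ := by
      rw [pow_succ]
      field_simp

end Asymptotics

end DistGraph

theorem claim2p14 (α : ℝ) (hα : Irrational α) (hα0 : 0 < α) (hα1 : α < 1)
    {V : Type*} [Finite V] (B : SimpleGraph V) (A : Set V)
    (hpr : DistGraph.LtPr α B A Set.univ) :
    IsGreatest (DistGraph.xiWeights α B A Set.univ) (DistGraph.xi α B A Set.univ) ∧
    ∀ ε : ℝ, 0 < ε → DistGraph.RandomEnough α (fun n M =>
      ∀ f : B.induce A ↪g M,
        (({g : B ↪g M | ∀ a : A, g (a : V) = f a}.ncard : ℕ) : ℝ) ≤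
          (n : ℝ) ^ (DistGraph.xi α B A Set.univ + ε)) := by
  classical
  refine ⟨hpr.isGreatest_xi hα hα0, fun ε hε => ?_⟩
  have := Fintype.ofFinite V
  set ξ := DistGraph.xi α B A Set.univ with hξ
  set m := Fintype.card V with hm
  set a := Nat.card A with ha
  set c := Fintype.card (Fin m ≃ V) with hc
  obtain ⟨k, hk⟩ := exists_nat_ge (((a : ℝ) + 1) / ε)
  rw [div_le_iff₀ hε, mul_comm] at hk
  -- Room for the image of `f` and for `k` copies, `m` points each; the remaining `m` is slack.
  set K := m + (k + 1) * m with hK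
  have hbound : ∀ n : ℕ, 3 ≤ n → 1 - DistGraph.prob α n (fun M => ∀ f : B.induce A ↪g M,
        (({g : B ↪g M | ∀ a : A, g (a : V) = f a}.ncard : ℕ) : ℝ) ≤ (n : ℝ) ^ (ξ + ε)) ≤
      ((c : ℝ) * (1 + 6 * K) ^ m) ^ k * (Real.log n ^ (m * k) / n) := by
    intro n hn
    have hn0 : (0 : ℝ) < n := by
      have : 0 < n := by omega
      exact_mod_cast this
    have hlog : 0 ≤ Real.log (n : ℝ) := Real.log_natCast_nonneg n
    refine (DistGraph.one_sub_prob_le hα0 B A (k := k)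
      (T := (n : ℝ) ^ ξ * (c * (1 + K * (4 + 2 * Real.log n)) ^ m))
      (Real.rpow_pos_of_pos hn0 _) fun f => ?_).trans (DistGraph.moment_ratio_le hn hk)
    have hcard : (Finset.univ.image f).card ≤ m :=
      Finset.card_image_le.trans (by
        rw [Finset.card_univ]
        exact Fintype.card_subtype_le _)
    have h := DistGraph.expect_copies_pow_le hα0 B f (K := K)
      (T := (n : ℝ) ^ ξ * (c * (1 + K * (4 + 2 * Real.log n)) ^ m)) (by positivity)
      (fun S hS hfS => DistGraph.sum_prod_len_rpow_le (by omega) S hα0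
        (fun D hD r => hpr.weight_le_xi hα hα0 hD r) hS _ fun g hg v hv => by
          rw [(Finset.mem_filter.1 hg).2.2 ⟨v, hv⟩]
          exact hfS _)
      k (Finset.univ.image f)
      (by
        rw [← hm, hK, Nat.succ_mul]
        omega)
      (fun x => Finset.mem_image_of_mem _ (Finset.mem_univ x)) ∅ (by simp)
    simpa using h
  have hlim := DistGraph.tendsto_log_pow_div (((c : ℝ) * (1 + 6 * K) ^ m) ^ k) (m * k)
  have hlow : Tendsto (fun n : ℕ => 1 - ((c : ℝ) * (1 + 6 * K) ^ m) ^ k *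
      (Real.log n ^ (m * k) / n)) atTop (𝓝 1) := by
    simpa using hlim.const_sub 1
  refine tendsto_of_tendsto_of_tendsto_of_le_of_le' hlow tendsto_const_nhds ?_
    (Eventually.of_forall fun n => DistGraph.prob_le_one hα0 n _)
  filter_upwards [eventually_ge_atTop 3] with n hn
  linarith [hbound n hn]
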